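/- Let $\aleph$ be an infinite cardinal. A topological space $Z$ is said to have (I$_\aleph$) if every locally finite family $(A_i)_{i\in I}$ of nonempty open subsets of $Z$ satisfies $|I|\le\aleph$, and to have (III$_\aleph$) if every family $(A_i)_{i\in I}$ of nonempty open subsets of $Z$ such that $|\{i\in I: z\in A_i\}|\le\aleph$ for every $z\in Z$ satisfies $|I|\le\aleph$. **Theorem.** Let $X$ be a Baire space which has (I$_\aleph$), and let $Y=\prod_{t\in T}Y_t$ be the topological product of a family of topological spaces such that $Y$ has (III$_\aleph$). Then every separately continuous function $f:X\times Y\to\mathbb R$ depends on at most $\aleph$ coordinates with respect to the second variable, i.e. there is a set $S\subseteq T$ with $|S|\le\aleph$ such that $f(x,y')=f(x,y'')$ for all $x\in X$ and all $y',y''\in Y$ with $y'|_S=y''|_S$. -/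

import Mathlib

universe u t w z v

/-- Condition (I) for the cardinal `κ`: every locally finite family of nonempty open subsets of `X`
has cardinality at most `κ`. The index types range over the universe of `κ`; as that universe
contains a type of cardinality the successor of `κ`, and the condition passes to subfamilies, this is
the same as admitting families indexed by arbitrary types. -/
def HasCondI (κ : Cardinal.{v}) (X : Type u) [TopologicalSpace X] : Prop :=
  ∀ (I : Type v) (A : I → Set X), (∀ i, IsOpen (A i)) → (∀ i, (A i).Nonempty) →
    LocallyFinite A → Cardinal.mk I ≤ κ

/-- A family of sets is `κ`-pointwise if every point belongs to at most `κ` members of it, counted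
with their indices. -/
def IsCardPointwise (κ : Cardinal.{v}) {X : Type u} {I : Type v} (A : I → Set X) : Prop :=
  ∀ x : X, Cardinal.mk {i : I // x ∈ A i} ≤ κ

/-- Condition (III) for the cardinal `κ`: every `κ`-pointwise family of nonempty open subsets of `X`
has cardinality at most `κ`. The same remark on index types applies as for condition (I). -/
def HasCondIII (κ : Cardinal.{v}) (X : Type u) [TopologicalSpace X] : Prop :=
  ∀ (I : Type v) (A : I → Set X), (∀ i, IsOpen (A i)) → (∀ i, (A i).Nonempty) →
    IsCardPointwise κ A → Cardinal.mk I ≤ κ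

/-- Continuity in each variable separately. -/
def SeparatelyContinuous {X Y Z : Type*} [TopologicalSpace X] [TopologicalSpace Y]
    [TopologicalSpace Z] (f : X × Y → Z) : Prop :=
  (∀ y : Y, Continuous fun x : X => f (x, y)) ∧ (∀ x : X, Continuous fun y : Y => f (x, y))

/-- A mapping on a product depends on at most `κ` coordinates if it is concentrated on some set `S`
of at most `κ` indices: `h y = h y'` whenever `y` and `y'` agree on `S`. -/
def DependsOnAtMost (κ : Cardinal.{v}) {T : Type t} {Y : T → Type w} {Z : Type z}
    (h : (∀ t, Y t) → Z) : Prop :=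
  ∃ S : Set T, Cardinal.lift.{v, t} (Cardinal.mk S) ≤ Cardinal.lift.{t, v} κ ∧ DependsOn h S

/-- `f` depends on at most `κ` coordinates with respect to the second variable: the associated
mapping `y ↦ f (·, y)` into the functions on `X` depends on at most `κ` coordinates. -/
def DependsOnAtMostSnd (κ : Cardinal.{v}) {X : Type u} {T : Type t}
    {Y : T → Type w} {Z : Type z} (f : X × (∀ t, Y t) → Z) : Prop :=
  DependsOnAtMost κ fun (y : ∀ t, Y t) (x : X) => f (x, y)

/-!
Let `S` be the set of coordinates `t` such that changing the `t`-th coordinate alone changes some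
value of `f`. Continuity in the second variable shows that `f` is concentrated on `S`, so the point
is that `S` has at most `κ` elements. Suppose not.

Choose more than `κ` distinct coordinates `τ i`, points `x i` and values `p i` such that changing
the coordinate `τ i` of some point to `p i` changes `f (x i, ·)` by more than a common `ε`. The
points whose value changes in this way form a nonempty open set, so condition (III) provides one
point `y` that serves for more than `κ` indices: the open sets
`{x | ε < |f (x, y) - f (x, y[τ i := p i])|}` are nonempty. Since `X` is a Baire space, they contain
nonempty open sets `W i` over which finitely many coordinates `G i` control `f (x, ·)` near `y` and
near `y[τ i := p i]`, uniformly in `x` (`exists_open_finset_forall_abs_sub_le`). A free set argument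
(`exists_large_free`) leaves more than `κ` indices such that `τ j ∉ G i` for `i ≠ j`, and by
condition (I) the remaining sets `W i` cluster at some `x₀`.

Now change *all* the remaining coordinates `τ i` of `y` to `p i`, which gives a point `y₁`, or only
finitely many of them, which gives a point `y₂` with `f (x₀, y₂)` close to `f (x₀, y₁)`. For `x`
close to `x₀` in a set `W i` whose index `i` is not among these finitely many, `f (x, y₁)` is close
to `f (x, y[τ i := p i])`, and `f (x, y₂)` is close to `f (x, y)`. So the last two values are within
`ε` of each other, a contradiction.
-/

open Cardinal Set Filter Topology

/-! ### Sets of cardinality greater than `κ` -/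

/-- If at most `κ` sets cover a set with more than `κ` elements, then one of them has more than `κ`
elements. -/
theorem exists_large_of_subset_iUnion {κ : Cardinal.{v}} (hκ : ℵ₀ ≤ κ) {I J : Type v}
    {A : Set I} (hA : ¬ #A ≤ κ) (hJ : #J ≤ κ) (B : J → Set I) (h : A ⊆ ⋃ j, B j) :
    ∃ j, ¬ #(B j) ≤ κ := by
  by_contra! hB
  refine hA ((mk_le_mk_of_subset h).trans ((mk_iUnion_le B).trans ?_))
  exact (mul_le_mul' hJ (ciSup_le' hB)).trans (mul_eq_self hκ).le

/-- If `τ` is injective and finite sets `G i` are attached to more than `κ` indices, then there are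
more than `κ` of these indices such that `τ j ∉ G i` whenever `i ≠ j`; here for sets `G i` of
bounded size. -/
theorem exists_large_free_of_card_le {κ : Cardinal.{v}} (hκ : ℵ₀ ≤ κ) {I : Type v} {T : Type t}
    {τ : I → T} (hτ : Function.Injective τ) (n : ℕ) (G : I → Finset T) (A : Set I)
    (hA : ¬ #A ≤ κ) (hG : ∀ i ∈ A, (G i).card ≤ n) :
    ∃ B ⊆ A, ¬ #B ≤ κ ∧ ∀ i ∈ B, ∀ j ∈ B, i ≠ j → τ j ∉ G i := by
  classical
  induction n generalizing G A with
  | zero =>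
    refine ⟨A, Subset.rfl, hA, fun i hi j _ _ => ?_⟩
    simp [Finset.card_eq_zero.mp (Nat.le_zero.mp (hG i hi))]
  | succ n ih =>
    obtain ⟨F, hF⟩ := zorn_subset {F : Set I | F ⊆ A ∧ ∀ i ∈ F, ∀ j ∈ F, i ≠ j → τ j ∉ G i} (by
      intro c hc hch
      refine ⟨⋃₀ c, ⟨sUnion_subset fun s hs => (hc hs).1, ?_⟩, fun s => subset_sUnion_of_mem⟩
      rintro i ⟨s, hs, hi⟩ j ⟨s', hs', hj⟩ hij
      rcases hch.total hs hs' with h | h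
      · exact (hc hs').2 i (h hi) j hj hij
      · exact (hc hs).2 i hi j (h hj) hij)
    by_cases hFκ : #F ≤ κ
    · -- By maximality every other index `i` satisfies `τ i ∈ G j` or `τ j ∈ G i` for some `j ∈ F`.
      -- Few indices are of the first kind, so some `τ j` lies in `G i` for many `i`; remove it.
      have hcov : A ⊆ ⋃ j : F, ({i | i = j} ∪ {i | τ i ∈ G j}) ∪ {i | i ∈ A ∧ τ j ∈ G i} := by
        intro i hi
        by_contra hcon
        simp only [mem_iUnion, mem_union, mem_ofPred_eq, not_exists, not_or, not_and] at hcon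
        have hins : insert i F ⊆ F := by
          refine hF.2 ⟨insert_subset hi hF.1.1, ?_⟩ (subset_insert i F)
          rintro a (rfl | ha) b (rfl | hb) hab
          · exact absurd rfl hab
          · exact (hcon ⟨b, hb⟩).2 hi
          · exact (hcon ⟨a, ha⟩).1.2
          · exact hF.1.2 a ha b hb hab
        exact (hcon ⟨i, hins (mem_insert i F)⟩).1.1 rfl
      obtain ⟨j, hj⟩ := exists_large_of_subset_iUnion hκ hA hFκ _ hcov
      have hlarge : ¬ #{i | i ∈ A ∧ τ j ∈ G i} ≤ κ := by
        intro hle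
        refine hj ((mk_union_le _ _).trans (add_le_of_le hκ ?_ hle))
        exact (((finite_singleton _).union
          ((G j).finite_toSet.preimage hτ.injOn)).lt_aleph0.le).trans hκ
      obtain ⟨B, hBA, hB, hfree⟩ := ih (fun i => (G i).erase (τ j)) _ hlarge (fun i hi => by
        rw [Finset.card_erase_of_mem hi.2]
        have := hG i hi.1
        omega)
      refine ⟨B \ {(j : I)}, fun i hi => (hBA hi.1).1, fun hle => hB ?_, ?_⟩
      · have hsub : B ⊆ (B \ {(j : I)}) ∪ {(j : I)} := by simp
        refine (mk_le_mk_of_subset hsub).trans ((mk_union_le _ _).trans (add_le_of_le hκ hle ?_))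
        exact (finite_singleton _).lt_aleph0.le.trans hκ
      · intro i hi k hk hik hmem
        exact hfree i hi.1 k hk.1 hik (Finset.mem_erase.mpr ⟨fun h => hk.2 (hτ h), hmem⟩)
    · exact ⟨F, hF.1.1, hFκ, hF.1.2⟩

theorem exists_large_free {κ : Cardinal.{v}} (hκ : ℵ₀ ≤ κ) {I : Type v} {T : Type t}
    {τ : I → T} (hτ : Function.Injective τ) (G : I → Finset T) (hI : ¬ #I ≤ κ) :
    ∃ B : Set I, ¬ #B ≤ κ ∧ ∀ i ∈ B, ∀ j ∈ B, i ≠ j → τ j ∉ G i := by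
  obtain ⟨n, hn⟩ := exists_large_of_subset_iUnion hκ (A := (univ : Set I)) (by rwa [mk_univ])
    (J := ULift.{v} ℕ) (by simpa using hκ) (fun n => {i | (G i).card ≤ n.down})
    (fun i _ => mem_iUnion.mpr ⟨⟨(G i).card⟩, le_refl (G i).card⟩)
  obtain ⟨B, -, hB, hfree⟩ := exists_large_free_of_card_le hκ hτ n.down G _ hn fun i hi => hi
  exact ⟨B, hB, hfree⟩

/-! ### Continuous functions on products -/

theorem tendsto_piecewise_atTop {T : Type t} [DecidableEq T] {Y : T → Type w}
    [∀ t, TopologicalSpace (Y t)] (y z : ∀ t, Y t) :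
    Tendsto (fun F : Finset T => F.piecewise y z) atTop (𝓝 y) := by
  refine tendsto_pi_nhds.mpr fun t => tendsto_const_nhds.congr' ?_
  filter_upwards [eventually_ge_atTop {t}] with F hF
  simp [Finset.singleton_subset_iff.mp hF]

/-- A continuous function on a product depends only on the coordinates which, changed alone, change
some value of the function. -/
theorem Continuous.eq_of_eqOn_essential {T : Type t} [DecidableEq T] {Y : T → Type w}
    [∀ t, TopologicalSpace (Y t)] {Z : Type*} [TopologicalSpace Z] [T2Space Z]
    {h : (∀ t, Y t) → Z} (hc : Continuous h) {S : Set T}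
    (hS : ∀ t ∉ S, ∀ y p, h (Function.update y t p) = h y) {y z : ∀ t, Y t}
    (hyz : ∀ t ∈ S, y t = z t) : h y = h z := by
  have hfin : ∀ F : Finset T, h (F.piecewise y z) = h z := by
    intro F
    induction F using Finset.induction_on with
    | empty => simp
    | insert t F _ ih =>
      rw [Finset.piecewise_insert]
      by_cases ht : t ∈ S
      · rw [Function.update_eq_self_iff.mpr, ih]
        by_cases htF : t ∈ F <;> simp [htF, hyz t ht]
      · rw [hS t ht, ih]
  refine tendsto_nhds_unique ((hc.tendsto y).comp (tendsto_piecewise_atTop y z)) ?_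
  exact tendsto_const_nhds.congr fun F => (hfin F).symm

/-- The function `h` has at least `k` jumps by more than `δ` at `y₀`, caused by changes of `y₀` on
pairwise disjoint finite sets of coordinates. -/
def HasJumps {T : Type t} {Y : T → Type w} (h : (∀ t, Y t) → ℝ) (y₀ : ∀ t, Y t) (δ : ℝ)
    (k : ℕ) : Prop :=
  ∃ (D : Fin k → Finset T) (z : Fin k → ∀ t, Y t), Pairwise (fun i j => Disjoint (D i) (D j)) ∧
    (∀ i, ∀ t ∉ D i, z i t = y₀ t) ∧ ∀ i, δ < |h (z i) - h y₀|

/-- A continuous function admits only boundedly many disjoint jumps: each of them involves one of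
the finitely many coordinates that control the function near `y₀`. -/
theorem Continuous.exists_not_hasJumps {T : Type t} {Y : T → Type w}
    [∀ t, TopologicalSpace (Y t)] {h : (∀ t, Y t) → ℝ} (hc : Continuous h) (y₀ : ∀ t, Y t)
    {δ : ℝ} (hδ : 0 < δ) : ∃ k, ¬ HasJumps h y₀ δ k := by
  have hopen : IsOpen {y | |h y - h y₀| < δ} :=
    isOpen_lt (hc.sub continuous_const).abs continuous_const
  obtain ⟨G, u, hu, hG⟩ := isOpen_pi_iff.mp hopen y₀ (by simpa using hδ)
  refine ⟨G.card + 1, ?_⟩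
  rintro ⟨D, z, hD, hz, hjump⟩
  have hmeet : ∀ i, ∃ t ∈ G, t ∈ D i := by
    intro i
    by_contra! hcon
    have hmem : z i ∈ (G : Set T).pi u := fun t ht => by
      rw [hz i t (hcon t ht)]
      exact (hu t ht).2
    exact (hjump i).not_gt (hG hmem)
  choose g hgG hgD using hmeet
  have hinj : Function.Injective fun i => (⟨g i, hgG i⟩ : G) := by
    intro i j hij
    by_contra hne
    have hg : g i = g j := congrArg Subtype.val hij
    exact Finset.disjoint_left.mp (hD hne) (hgD i) (hg ▸ hgD j)
  simpa using Fintype.card_le_of_injective _ hinj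

/-! ### Local control by finitely many coordinates -/

theorem isOpen_setOf_hasJumps {X : Type u} [TopologicalSpace X] {T : Type t} {Y : T → Type w}
    {f : X × (∀ t, Y t) → ℝ} (hf : ∀ y, Continuous fun x => f (x, y)) (y₀ : ∀ t, Y t) (δ : ℝ)
    (k : ℕ) : IsOpen {x | HasJumps (fun y => f (x, y)) y₀ δ k} := by
  refine isOpen_iff_mem_nhds.mpr ?_
  rintro x ⟨D, z, hD, hz, hjump⟩
  have hopen : IsOpen (⋂ i, {x | δ < |f (x, z i) - f (x, y₀)|}) :=
    isOpen_iInter_of_finite fun i => isOpen_lt continuous_const ((hf _).sub (hf _)).abs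
  filter_upwards [hopen.mem_nhds (mem_iInter.mpr hjump)] with x' hx'
  exact ⟨D, z, hD, hz, mem_iInter.mp hx'⟩

/-- If the number of disjoint jumps at `y₀` is bounded on `V`, then a point of `V` with the most
jumps has a neighbourhood on which every large change of `f (x, ·)` involves one of the finitely
many coordinates used by these jumps. -/
theorem exists_open_finset_of_not_hasJumps {X : Type u} [TopologicalSpace X] {T : Type t}
    {Y : T → Type w} [∀ t, TopologicalSpace (Y t)] {f : X × (∀ t, Y t) → ℝ}
    (hf : SeparatelyContinuous f) (y₀ : ∀ t, Y t) (δ : ℝ) (k : ℕ) {V : Set X} (hV : IsOpen V)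
    (hne : V.Nonempty) (hk : ∀ x ∈ V, ¬ HasJumps (fun y => f (x, y)) y₀ δ k) :
    ∃ W ⊆ V, IsOpen W ∧ W.Nonempty ∧ ∃ G : Finset T, ∀ x ∈ W, ∀ y : ∀ t, Y t,
      (∀ t ∈ G, y t = y₀ t) → |f (x, y) - f (x, y₀)| ≤ δ := by
  classical
  induction k with
  | zero =>
    obtain ⟨x, hx⟩ := hne
    exact (hk x hx ⟨Fin.elim0, Fin.elim0, fun i => i.elim0, fun i => i.elim0,
      fun i => i.elim0⟩).elim
  | succ k ih =>
    by_cases hex : ∃ x ∈ V, HasJumps (fun y => f (x, y)) y₀ δ k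
    · obtain ⟨x₁, hx₁, D, z, hD, hz, hjump⟩ := hex
      refine ⟨V ∩ ⋂ i, {x | δ < |f (x, z i) - f (x, y₀)|}, inter_subset_left,
        hV.inter (isOpen_iInter_of_finite fun i =>
          isOpen_lt continuous_const ((hf.1 _).sub (hf.1 _)).abs),
        ⟨x₁, hx₁, mem_iInter.mpr hjump⟩, Finset.univ.biUnion D, ?_⟩
      rintro x ⟨hxV, hx⟩ y hy
      by_contra! hlt
      -- Finitely many of the changes leading from `y₀` to `y` already produce a jump.
      have hev : ∀ᶠ F : Finset T in atTop, δ < |f (x, F.piecewise y y₀) - f (x, y₀)| :=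
        ((((hf.2 x).tendsto y).comp (tendsto_piecewise_atTop y y₀)).sub_const _).abs.eventually
          (lt_mem_nhds hlt)
      obtain ⟨F, hF⟩ := hev.exists
      have hdisj : ∀ i, Disjoint (F \ Finset.univ.biUnion D) (D i) := fun i =>
        Finset.disjoint_left.mpr fun t ht hti =>
          (Finset.mem_sdiff.mp ht).2 (Finset.mem_biUnion.mpr ⟨i, Finset.mem_univ i, hti⟩)
      refine hk x hxV ⟨Fin.cons (F \ Finset.univ.biUnion D) D, Fin.cons (F.piecewise y y₀) z,
        ?_, ?_, ?_⟩
      · intro i j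
        refine Fin.cases ?_ (fun i => ?_) i <;> refine Fin.cases ?_ (fun j => ?_) j
        · exact fun h => absurd rfl h
        · exact fun _ => hdisj j
        · exact fun _ => (hdisj i).symm
        · exact fun h => hD fun hij => h (congrArg Fin.succ hij)
      · refine Fin.cases (fun t ht => ?_) hz
        rw [Fin.cons_zero, Finset.mem_sdiff, not_and, not_not] at ht
        by_cases htF : t ∈ F
        · simpa [htF] using hy t (ht htF)
        · simp [htF]
      · exact Fin.cases hF (mem_iInter.mp hx)
    · push Not at hex
      exact ih hex

/-- Over a Baire space the closed sets on which the number of disjoint jumps at `y₀` is bounded by a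
given `k` cover every open set `V`, so one of them has interior in `V`. Hence finitely many
coordinates control `f (x, ·)` near `y₀`, uniformly for `x` in a nonempty open subset of `V`. -/
theorem exists_open_finset_forall_abs_sub_le {X : Type u} [TopologicalSpace X] [BaireSpace X]
    {T : Type t} {Y : T → Type w} [∀ t, TopologicalSpace (Y t)] {f : X × (∀ t, Y t) → ℝ}
    (hf : SeparatelyContinuous f) (y₀ : ∀ t, Y t) {δ : ℝ} (hδ : 0 < δ) {V : Set X}
    (hV : IsOpen V) (hne : V.Nonempty) :
    ∃ W ⊆ V, IsOpen W ∧ W.Nonempty ∧ ∃ G : Finset T, ∀ x ∈ W, ∀ y : ∀ t, Y t,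
      (∀ t ∈ G, y t = y₀ t) → |f (x, y) - f (x, y₀)| ≤ δ := by
  have := hV.baireSpace
  have := hne.to_subtype
  obtain ⟨k, hk⟩ := nonempty_interior_of_iUnion_of_closed
    (f := fun k : ℕ => {x : V | ¬ HasJumps (fun y => f (x, y)) y₀ δ k})
    (fun k => ((isOpen_setOf_hasJumps hf.1 y₀ δ k).preimage continuous_subtype_val).isClosed_compl)
    (eq_univ_of_forall fun x => mem_iUnion.mpr ((hf.2 x).exists_not_hasJumps y₀ hδ))
  obtain ⟨W, hWV, hW⟩ := exists_open_finset_of_not_hasJumps hf y₀ δ k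
    (hV.isOpenMap_subtype_val _ isOpen_interior) (hk.image _) (by
      rintro _ ⟨x, hx, rfl⟩
      exact interior_subset hx)
  exact ⟨W, hWV.trans (Subtype.coe_image_subset _ _), hW⟩

/-! ### The number of essential coordinates -/

/-- Condition (III) provides a single point `y` at which many coordinates are essential. -/
theorem HasCondIII.exists_large_common {κ : Cardinal.{v}} (hκ : ℵ₀ ≤ κ) {X : Type u} {T : Type t}
    [DecidableEq T] {Y : T → Type w} [∀ t, TopologicalSpace (Y t)]
    (hY : HasCondIII κ (∀ t, Y t)) {f : X × (∀ t, Y t) → ℝ}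
    (hf : ∀ x, Continuous fun y => f (x, y)) {I : Type v} (hI : ¬ #I ≤ κ) (τ : I → T)
    (hess : ∀ i, ∃ x y p, f (x, Function.update y (τ i) p) ≠ f (x, y)) :
    ∃ (ε : ℝ) (y : ∀ t, Y t) (p : ∀ i, Y (τ i)) (A : Set I), 0 < ε ∧ ¬ #A ≤ κ ∧
      ∀ i ∈ A, ∃ x, ε < |f (x, Function.update y (τ i) (p i)) - f (x, y)| := by
  choose x y p hxyp using hess
  obtain ⟨n, hn⟩ := exists_large_of_subset_iUnion hκ (A := (univ : Set I)) (by rwa [mk_univ])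
    (J := ULift.{v} ℕ) (by simpa using hκ)
    (fun n => {i | 1 / ((n.down : ℝ) + 1) <
      |f (x i, Function.update (y i) (τ i) (p i)) - f (x i, y i)|})
    (fun i _ => by
      obtain ⟨n, hn⟩ := exists_nat_one_div_lt (abs_pos.mpr (sub_ne_zero.mpr (hxyp i)))
      exact mem_iUnion.mpr ⟨⟨n⟩, hn⟩)
  set ε : ℝ := 1 / ((n.down : ℝ) + 1)
  set A₀ := {i | ε < |f (x i, Function.update (y i) (τ i) (p i)) - f (x i, y i)|}
  have hcommon : ¬ IsCardPointwise κ fun i : A₀ =>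
      {y | ε < |f (x i, Function.update y (τ i) (p i)) - f (x i, y)|} := fun h =>
    hn (hY A₀ _ (fun i => isOpen_lt continuous_const
      (((hf _).comp (continuous_id.update _ continuous_const)).sub (hf _)).abs)
      (fun i => ⟨y i, i.2⟩) h)
  obtain ⟨y', hy'⟩ := not_forall.mp hcommon
  refine ⟨ε, y', p, {i | ε < |f (x i, Function.update y' (τ i) (p i)) - f (x i, y')|},
    Nat.one_div_pos_of_nat, fun hle => hy' (le_trans ?_ hle), fun i hi => ⟨x i, hi⟩⟩
  exact mk_le_of_injective (f := fun i => ⟨i.1.1, i.2⟩)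
    fun i j h => Subtype.ext (Subtype.ext (congrArg (fun a => a.1) h))

/-- At a single point `y`, the coordinates `τ i` cannot be changed at `y` by more than `ε` for more
than `κ` indices `i`: otherwise changing many of them at once produces a discontinuity of `f` in
one of the variables. -/
theorem mk_le_of_forall_exists_lt_abs_sub {κ : Cardinal.{v}} (hκ : ℵ₀ ≤ κ) {X : Type u}
    [TopologicalSpace X] [BaireSpace X] (hX : HasCondI κ X) {T : Type t} [DecidableEq T]
    {Y : T → Type w} [∀ t, TopologicalSpace (Y t)] {f : X × (∀ t, Y t) → ℝ}
    (hf : SeparatelyContinuous f) {I : Type v} {τ : I → T} (hτ : Function.Injective τ)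
    {ε : ℝ} (hε : 0 < ε) (y : ∀ t, Y t) (p : ∀ i, Y (τ i))
    (hjump : ∀ i, ∃ x, ε < |f (x, Function.update y (τ i) (p i)) - f (x, y)|) : #I ≤ κ := by
  classical
  by_contra hI
  have hδ : 0 < ε / 8 := by positivity
  have hlocal : ∀ i, ∃ W : Set X, IsOpen W ∧ W.Nonempty ∧
      (∀ x ∈ W, ε < |f (x, Function.update y (τ i) (p i)) - f (x, y)|) ∧ ∃ G : Finset T,
      ∀ x ∈ W, ∀ z : ∀ t, Y t, ((∀ t ∈ G, z t = y t) → |f (x, z) - f (x, y)| ≤ ε / 8) ∧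
        ((∀ t ∈ G, z t = Function.update y (τ i) (p i) t) →
          |f (x, z) - f (x, Function.update y (τ i) (p i))| ≤ ε / 8) := by
    intro i
    obtain ⟨V, hV, hVo, hVne, G, hG⟩ := exists_open_finset_forall_abs_sub_le hf y hδ
      (V := {x | ε < |f (x, Function.update y (τ i) (p i)) - f (x, y)|})
      (isOpen_lt continuous_const ((hf.1 _).sub (hf.1 _)).abs) (hjump i)
    obtain ⟨W, hW, hWo, hWne, H, hH⟩ := exists_open_finset_forall_abs_sub_le hf
      (Function.update y (τ i) (p i)) hδ hVo hVne
    refine ⟨W, hWo, hWne, fun x hx => hV (hW hx), G ∪ H, fun x hx z => ⟨fun hz => ?_, fun hz => ?_⟩⟩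
    · exact hG x (hW hx) z fun t ht => hz t (Finset.mem_union_left _ ht)
    · exact hH x hx z fun t ht => hz t (Finset.mem_union_right _ ht)
  choose W hWo hWne hWjump G hG using hlocal
  obtain ⟨B, hB, hfree⟩ := exists_large_free hκ hτ G hI
  have hcluster : ¬ LocallyFinite fun i : B => W i := fun h =>
    hB (hX B _ (fun i => hWo i) (fun i => hWne i) h)
  simp only [LocallyFinite, not_forall, not_exists, not_and] at hcluster
  obtain ⟨x₀, hx₀⟩ := hcluster
  obtain ⟨y₁, hy₁, hy₁'⟩ : ∃ y₁ : ∀ t, Y t, (∀ i ∈ B, y₁ (τ i) = p i) ∧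
      ∀ t, (∀ i ∈ B, τ i ≠ t) → y₁ t = y t := by
    have hex : ∀ t, ∃ q : Y t, (∀ i ∈ B, ∀ h : τ i = t, q = h ▸ p i) ∧
        ((∀ i ∈ B, τ i ≠ t) → q = y t) := by
      intro t
      by_cases ht : ∃ i ∈ B, τ i = t
      · obtain ⟨i, hi, rfl⟩ := ht
        refine ⟨p i, fun j _ h => ?_, fun h => absurd rfl (h i hi)⟩
        obtain rfl := hτ h
        rfl
      · push Not at ht
        exact ⟨y t, fun i hi h => absurd h (ht i hi), fun _ => rfl⟩
    choose q hq hq' using hex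
    exact ⟨q, fun i hi => hq _ i hi rfl, hq'⟩
  have hev : ∀ᶠ F : Finset T in atTop, |f (x₀, F.piecewise y₁ y) - f (x₀, y₁)| < ε / 8 :=
    ((((hf.2 x₀).tendsto y₁).comp (tendsto_piecewise_atTop y₁ y)).sub_const _).abs.eventually
      (gt_mem_nhds (by simpa using hδ))
  obtain ⟨F, hF⟩ := hev.exists
  have hnear : ∀ z, {x | |f (x, z) - f (x₀, z)| < ε / 8} ∈ 𝓝 x₀ := fun z =>
    (isOpen_lt ((hf.1 z).sub continuous_const).abs continuous_const).mem_nhds (by simpa using hδ)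
  -- Infinitely many of the sets `W i` come close to `x₀`; pick one with `τ i ∉ F`.
  have hinf := hx₀ _ (inter_mem (hnear y₁) (hnear (F.piecewise y₁ y)))
  have hFfin : {i : B | τ i ∈ F}.Finite :=
    F.finite_toSet.preimage (hτ.comp Subtype.val_injective).injOn
  obtain ⟨i, ⟨x, hxW, hx₁, hx₂⟩, hiF⟩ := (Set.Infinite.sdiff hinf hFfin).nonempty
  have h₁ := (hG i x hxW y₁).2 fun t ht => by
    by_cases hti : t = τ i
    · subst hti
      simpa using hy₁ i i.2
    · rw [Function.update_of_ne hti]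
      refine hy₁' t fun j hj hjt => hfree i i.2 j hj (fun hij => hti (by rw [← hjt, hij])) ?_
      rwa [hjt]
  have h₂ := (hG i x hxW (F.piecewise y₁ y)).1 fun t ht => by
    by_cases htF : t ∈ F
    · rw [Finset.piecewise_eq_of_mem _ _ _ htF]
      refine hy₁' t fun j hj hjt => hfree i i.2 j hj (fun hij => hiF ?_) ?_
      · simpa [hij, hjt] using htF
      · rwa [hjt]
    · simp [htF]
  have h₃ := hWjump i x hxW
  simp only [mem_ofPred_eq] at hx₁ hx₂
  rw [lt_abs] at h₃
  rw [abs_lt] at hx₁ hx₂ hF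
  rw [abs_le] at h₁ h₂
  rcases h₃ with h₃ | h₃ <;>
    linarith [h₁.1, h₁.2, h₂.1, h₂.2, hx₁.1, hx₁.2, hx₂.1, hx₂.2, hF.1, hF.2]

theorem theorem2p5 (κ : Cardinal.{v}) (hκ : Cardinal.aleph0 ≤ κ)
    (X : Type u) [TopologicalSpace X] [BaireSpace X] (hX : HasCondI κ X)
    (T : Type t) (Y : T → Type w) [∀ t, TopologicalSpace (Y t)]
    (hY : HasCondIII κ (∀ t, Y t))
    (f : X × (∀ t, Y t) → ℝ) (hf : SeparatelyContinuous f) :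
    DependsOnAtMostSnd κ f := by
  classical
  refine ⟨{t | ∃ x y p, f (x, Function.update y t p) ≠ f (x, y)}, ?_, fun y z hyz => ?_⟩
  · by_contra hlarge
    have hsucc := Order.succ_le_of_lt (not_le.mp hlarge)
    rw [← lift_succ, ← mk_out (Order.succ κ), lift_mk_le'] at hsucc
    obtain ⟨e⟩ := hsucc
    obtain ⟨ε, y, p, A, hε, hA, hjump⟩ := hY.exists_large_common hκ hf.2
      (I := (Order.succ κ).out) (by simp) (fun i => (e i : T)) fun i => (e i).2
    exact hA (mk_le_of_forall_exists_lt_abs_sub hκ hX hf (τ := fun i : A => (e i : T))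
      (fun i j h => Subtype.ext (e.injective (Subtype.ext h))) hε y (fun i => p i)
      fun i => hjump i i.2)
  · funext x
    refine (hf.2 x).eq_of_eqOn_essential (fun t ht y p => ?_) hyz
    by_contra h
    exact ht ⟨x, y, p, h⟩
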